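/- A tree is a nonempty set $T\subseteq\omega^{<\omega}$ closed under initial segments, $[T]=\{x\in\omega^\omega:\forall n\ x|_n\in T\}$ is its body, and $\mathrm{succ}_T(\sigma)=\{n:\sigma^\frown n\in T\}$. For a collection $\mathbb T$ of trees and $T\in\mathbb T$ let $\mathbb T|T=\{S\in\mathbb T:S\subseteq T\}$. Let $t^0(\mathbb T)$ be the family of all $X\subseteq\omega^\omega$ such that every $T\in\mathbb T$ contains some $S\in\mathbb T$ with $[S]\cap X=\emptyset$, and let $t^0_{\mathcal B}(\mathbb T)$ be the $\sigma$-ideal generated by the Borel members of $t^0(\mathbb T)$. Let $\mathrm{is}(\mathbb T)$ be the least cardinality of a family $\mathcal A\subseteq t^0_{\mathcal B}(\mathbb T)$ such that $\bigcup\mathcal A\cap[T]\neq\emptyset$ for every $T\in\mathbb T$, and let $\mathrm{is}_h(\mathbb T)=\min\{\mathrm{is}(\mathbb T|T):T\in\mathbb T\}$. For a $\sigma$-ideal $\mathcal J$ on $\omega^\omega$ let $\mathrm{cov}(\mathcal J)$ be the least cardinality of a family $\mathcal A\subseteq\mathcal J$ with $\bigcup\mathcal A=\omega^\omega$, and let $\mathrm{cov}_h(\mathcal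 J)$ be the least cardinality of a family $\mathcal A\subseteq\mathcal J$ whose union contains a Borel set not in $\mathcal J$. Let $\mathfrak b$ be the bounding number, the least cardinality of a subset of $\omega^\omega$ that is unbounded with respect to eventual domination. Call $\mathbb T$ homogeneous if for every $T\in\mathbb T$ there is a homeomorphism $h:\omega^\omega\to[T]$ such that every $X\subseteq\omega^\omega$ contains the body of a tree in $\mathbb T$ if and only if $h[X]$ does. For an ideal $\mathcal I$ on $\omega$ let $\mathbb M_{\mathcal I}$ be the collection of all trees $T$ such that every $\sigma\in T$ has an extension $\tau\in T$ with $\mathrm{succ}_T(\tau)\notin\mathcal I$, and let $m^0_{\mathcal B}(\mathcal I)=t^0_{\mathcal B}(\mathbb M_{\mathcal I})$. Let $\mathbb{FM}$ be the collection of all trees $T$ such that every $\sigma\in T$ has an extension $\tau\in T$ with $\mathrm{succ}_T(\tau)=\omega$, and let $fm^0_{\mathcal B}=t^0_{\mathcal B}(\mathbb{FM})$. **Theorem.** (1) For every proper ideal $\mathcal I$ on $\omega$ that contains all finite sets, $$\min\{\mathfrak b,\mathrm{cov}_h(m^0_{\mathcal B}(\mathcal I))\}\le\mathrm{is}_h(\mathbb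 M_{\mathcal I})\le\mathrm{cov}_h(m^0_{\mathcal B}(\mathcal I)).$$ If moreover $\mathbb M_{\mathcal I}$ is homogeneous, then $$\min\{\mathfrak b,\mathrm{cov}(m^0_{\mathcal B}(\mathcal I))\}\le\mathrm{is}(\mathbb M_{\mathcal I})\le\mathrm{cov}(m^0_{\mathcal B}(\mathcal I)).$$ (2) For full-splitting Miller trees, $$\min\{\mathfrak b,\mathrm{cov}_h(fm^0_{\mathcal B})\}\le\mathrm{is}_h(\mathbb{FM})\le\mathrm{cov}_h(fm^0_{\mathcal B})\quad\text{and}\quad\min\{\mathfrak b,\mathrm{cov}(fm^0_{\mathcal B})\}\le\mathrm{is}(\mathbb{FM})\le\mathrm{cov}(fm^0_{\mathcal B}).$$ -/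

import Mathlib

open Cardinal Filter

namespace MillerIdeals

/-- The initial segment `x ↾ n` of `x ∈ ω^ω`, as a finite sequence. -/
def initSeg (x : ℕ → ℕ) (n : ℕ) : List ℕ := (List.range n).map x

/-- The set `[T]` of branches of a tree `T ⊆ ω^{<ω}`. -/
def body (T : Descriptive.tree ℕ) : Set (ℕ → ℕ) := {x | ∀ n, initSeg x n ∈ T}

/-- The set `succ_T(σ)` of immediate successors of `σ` in `T`. -/
def succs (T : Descriptive.tree ℕ) (σ : List ℕ) : Set ℕ := {n | σ ++ [n] ∈ T}

/-- The collection of `I`-Miller trees: the nonempty trees in which every node extends to a node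
whose set of immediate successors is not in `I`. -/
def MillerTrees (I : Order.Ideal (Set ℕ)) : Set (Descriptive.tree ℕ) :=
  {T | [] ∈ T ∧ ∀ σ ∈ T, ∃ τ ∈ T, σ <+: τ ∧ succs T τ ∉ I}

/-- The collection of full-splitting Miller trees: the nonempty trees in which every node extends
to a node all of whose one-step extensions belong to the tree. -/
def FullMillerTrees : Set (Descriptive.tree ℕ) :=
  {T | [] ∈ T ∧ ∀ σ ∈ T, ∃ τ ∈ T, σ <+: τ ∧ ∀ i : ℕ, τ ++ [i] ∈ T}

/-- The collection `𝕋 | T` of the trees in `𝕋` that are contained in `T`. -/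
def below (𝕋 : Set (Descriptive.tree ℕ)) (T : Descriptive.tree ℕ) : Set (Descriptive.tree ℕ) :=
  {S | S ∈ 𝕋 ∧ S ≤ T}

/-- The tree ideal `t⁰` associated to `𝕋`. -/
def treeIdeal (𝕋 : Set (Descriptive.tree ℕ)) : Set (Set (ℕ → ℕ)) :=
  {X | ∀ T ∈ 𝕋, ∃ S ∈ 𝕋, S ≤ T ∧ body S ∩ X = ∅}

/-- `A` is a Borel subset of `ω^ω` (product topology, `ω` discrete). -/
def IsBorel (A : Set (ℕ → ℕ)) : Prop := @MeasurableSet (ℕ → ℕ) (borel (ℕ → ℕ)) A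

/-- The Borel part of the tree ideal: the σ-ideal generated by its Borel members, that is, all
sets covered by countably many Borel members of the tree ideal. -/
def borelPart (𝕋 : Set (Descriptive.tree ℕ)) : Set (Set (ℕ → ℕ)) :=
  {X | ∃ N : ℕ → Set (ℕ → ℕ), (∀ n, N n ∈ treeIdeal 𝕋 ∧ IsBorel (N n)) ∧ X ⊆ ⋃ n, N n}

/-- The covering number of `J`. -/
noncomputable def cov (J : Set (Set (ℕ → ℕ))) : Cardinal.{0} :=
  sInf {κ | ∃ A : Set (Set (ℕ → ℕ)), A ⊆ J ∧ ⋃₀ A = Set.univ ∧ #A = κ}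

/-- The hereditary covering number of `J`: the least size of a subfamily of `J` whose union covers
some Borel set that is not in `J`. -/
noncomputable def covH (J : Set (Set (ℕ → ℕ))) : Cardinal.{0} :=
  sInf {κ | ∃ A : Set (Set (ℕ → ℕ)), A ⊆ J ∧ (∃ B, IsBorel B ∧ B ∉ J ∧ B ⊆ ⋃₀ A) ∧ #A = κ}

/-- The incompatibility shrinking number of `𝕋`: the least size of a subfamily of the Borel part
whose union intersects `[T]` for every `T ∈ 𝕋`. -/
noncomputable def shrinkNum (𝕋 : Set (Descriptive.tree ℕ)) : Cardinal.{0} :=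
  sInf {κ | ∃ A : Set (Set (ℕ → ℕ)), A ⊆ borelPart 𝕋 ∧
    (∀ T ∈ 𝕋, (⋃₀ A ∩ body T).Nonempty) ∧ #A = κ}

/-- The hereditary shrinking number of `𝕋`: the least cardinal of the form `is(𝕋 | T)`, for
`T ∈ 𝕋`. -/
noncomputable def shrinkNumH (𝕋 : Set (Descriptive.tree ℕ)) : Cardinal.{0} :=
  sInf {κ | ∃ T ∈ 𝕋, shrinkNum (below 𝕋 T) = κ}

/-- The bounding number `𝔟`: the least size of a family of functions `ω → ω` not dominated, up to
finitely many values, by a single function. -/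
noncomputable def boundingNumber : Cardinal.{0} :=
  sInf {κ | ∃ F : Set (ℕ → ℕ), (¬ ∃ g : ℕ → ℕ, ∀ f ∈ F, ∀ᶠ n in atTop, f n ≤ g n) ∧ #F = κ}

/-- `X` contains the body of a tree in `𝕋`. -/
def ContainsBody (𝕋 : Set (Descriptive.tree ℕ)) (X : Set (ℕ → ℕ)) : Prop :=
  ∃ S ∈ 𝕋, body S ⊆ X

/-- Homogeneity of `𝕋`: for every `T ∈ 𝕋` there is a homeomorphism `h : ω^ω → [T]` such that every
set `X ⊆ ω^ω` contains the body of a tree in `𝕋` if and only if `h[X]` does. -/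
def Homogeneous (𝕋 : Set (Descriptive.tree ℕ)) : Prop :=
  ∀ T ∈ 𝕋, ∃ h : (ℕ → ℕ) ≃ₜ body T, ∀ X : Set (ℕ → ℕ),
    ContainsBody 𝕋 X ↔ ContainsBody 𝕋 ((fun x => (h x : ℕ → ℕ)) '' X)

end MillerIdeals

/-! Both collections are of one kind: every node extends to one whose successor set is positive, for
an upward closed family `P` of sets with at least two elements (`IsPosFamily`). The σ-ideal is
identified by a perfect-set dichotomy: an analytic set contains the body of such a tree or is
covered by countably many bodies of trees with no positively splitting node
(`negligible_or_containsBody`). Sets of the second kind lie in the tree ideal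
(`Negligible.mem_treeIdeal`), so they are exactly the Borel part (`mem_borelPart_iff`).

The upper bounds hold because a cover of `[T]` meets every tree below `T`. The lower bounds rest on
`exists_body_subset_sUnion`. Let fewer than 𝔟 sets of the ideal meet every tree below `T`, and
suppose that no body is covered by so few sets. Then through each node σ of `T` runs a branch `x σ`
avoiding all the closed pieces that cover the given sets, and it leaves each piece after finitely
many steps. One function `g` dominates all these exit times. A tree that follows `x σ` up to the
level given by `g` after each splitting misses every given set, a contradiction. So some body is
covered, which bounds `covH`; homogeneity pulls the cover back to the whole space, which bounds
`cov`. -/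

namespace MillerIdeals

/-! ### Initial segments and basic clopen sets -/

section InitialSegments

/-- The basic clopen set of all sequences extending `σ`. -/
def cyl (σ : List ℕ) : Set (ℕ → ℕ) := {x | initSeg x σ.length = σ}

@[simp] lemma length_initSeg (x : ℕ → ℕ) (n : ℕ) : (initSeg x n).length = n := by
  simp [initSeg]

lemma initSeg_succ (x : ℕ → ℕ) (n : ℕ) : initSeg x (n + 1) = initSeg x n ++ [x n] := by
  simp [initSeg, List.range_succ]

@[simp] lemma getElem_initSeg (x : ℕ → ℕ) {n i : ℕ} (h : i < (initSeg x n).length) :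
    (initSeg x n)[i] = x i := by
  simp [initSeg]

lemma initSeg_prefix (x : ℕ → ℕ) {m n : ℕ} (h : m ≤ n) : initSeg x m <+: initSeg x n := by
  induction n, h using Nat.le_induction with
  | base => exact List.prefix_rfl
  | succ n _ ih => rw [initSeg_succ]; exact ih.trans (List.prefix_append _ _)

lemma mem_cyl_of_prefix {x : ℕ → ℕ} {σ : List ℕ} {n : ℕ} (h : σ <+: initSeg x n) : x ∈ cyl σ := by
  have hl : σ.length ≤ n := by simpa using h.length_le
  exact ((List.prefix_of_prefix_length_le h (initSeg_prefix x hl) (by simp)).eq_of_length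
    (by simp)).symm

lemma prefix_of_mem_cyl {x : ℕ → ℕ} {σ : List ℕ} {n : ℕ} (h : x ∈ cyl σ) (hn : σ.length ≤ n) :
    σ <+: initSeg x n := by
  have := initSeg_prefix x hn
  rwa [show initSeg x σ.length = σ from h] at this

lemma mem_cyl_initSeg (x : ℕ → ℕ) (n : ℕ) : x ∈ cyl (initSeg x n) :=
  mem_cyl_of_prefix List.prefix_rfl

lemma cyl_anti {σ τ : List ℕ} (h : σ <+: τ) : cyl τ ⊆ cyl σ := fun _ hx =>
  mem_cyl_of_prefix (h.trans (prefix_of_mem_cyl hx le_rfl))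

lemma mem_cyl_append {x : ℕ → ℕ} {σ : List ℕ} {n : ℕ} :
    x ∈ cyl (σ ++ [n]) ↔ x ∈ cyl σ ∧ x σ.length = n := by
  constructor
  · intro h
    have h' : initSeg x (σ ++ [n]).length = σ ++ [n] := h
    rw [List.length_append, List.length_singleton, initSeg_succ] at h'
    obtain ⟨h1, h2⟩ := List.append_inj h' (by simp)
    exact ⟨h1, by simpa using h2⟩
  · rintro ⟨h1, rfl⟩
    change initSeg x (σ ++ [x σ.length]).length = _
    rw [List.length_append, List.length_singleton, initSeg_succ,
      show initSeg x σ.length = σ from h1]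

lemma prefix_total_of_mem_cyl {x : ℕ → ℕ} {σ τ : List ℕ} (hσ : x ∈ cyl σ) (hτ : x ∈ cyl τ)
    (h : σ.length ≤ τ.length) : σ <+: τ := by
  have := prefix_of_mem_cyl hσ h
  rwa [show initSeg x τ.length = τ from hτ] at this

/-- Sequences agreeing on arbitrarily long initial segments are equal. -/
lemma eq_of_forall_exists_cyl {x y : ℕ → ℕ}
    (h : ∀ m, ∃ σ : List ℕ, m < σ.length ∧ x ∈ cyl σ ∧ y ∈ cyl σ) : x = y := by
  funext m
  obtain ⟨σ, hm, hx, hy⟩ := h m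
  have e : initSeg x σ.length = initSeg y σ.length :=
    (show initSeg x σ.length = σ from hx).trans (show initSeg y σ.length = σ from hy).symm
  have := congrArg (fun l : List ℕ => l[m]?) e
  simpa [initSeg, hm] using this

lemma isOpen_cyl (σ : List ℕ) : IsOpen (cyl σ) := by
  have : cyl σ = ⋂ i : Fin σ.length, (fun x : ℕ → ℕ => x i) ⁻¹' {σ[i]} := by
    ext x
    simp only [cyl, Set.mem_ofPred_eq, Set.mem_iInter, Set.mem_preimage, Set.mem_singleton_iff]
    constructor
    · intro h i
      have := congrArg (fun l : List ℕ => l[(i : ℕ)]?) h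
      simpa [initSeg] using this
    · intro h
      refine List.ext_getElem (by simp) fun i h1 h2 => ?_
      simpa using h ⟨i, h2⟩
  rw [this]
  exact isOpen_iInter_of_finite fun i => (isOpen_discrete _).preimage (continuous_apply _)

lemma exists_cyl_subset {U : Set (ℕ → ℕ)} (hU : IsOpen U) {x : ℕ → ℕ} (hx : x ∈ U) :
    ∃ n, ∀ m, n ≤ m → cyl (initSeg x m) ⊆ U := by
  obtain ⟨V, ⟨y, n, rfl⟩, hxV, hVU⟩ :=
    (PiNat.isTopologicalBasis_cylinders (fun _ : ℕ => ℕ)).exists_subset_of_mem_open hx hU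
  refine ⟨n, fun m hm z hz => hVU ?_⟩
  rw [PiNat.mem_cylinder_iff] at hxV ⊢
  intro i hi
  rw [← hxV i hi]
  have e : initSeg z m = initSeg x m := by
    have : initSeg z (initSeg x m).length = initSeg x m := hz
    rwa [length_initSeg] at this
  have := congrArg (fun l : List ℕ => l[i]?) e
  simpa [initSeg, hi.trans_le hm] using this

lemma le_length_of_lt_succ {s : ℕ → List ℕ} (hl : ∀ k, (s k).length < (s (k + 1)).length) (k : ℕ) :
    k ≤ (s k).length := by
  induction k with
  | zero => simp
  | succ k ih => exact Nat.succ_le_of_lt (ih.trans_lt (hl k))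

/-- Increasing finite sequences converge to a point of `ω^ω`. -/
lemma exists_mem_cyl_of_chain (s : ℕ → List ℕ) (hs : ∀ k, s k <+: s (k + 1))
    (hl : ∀ k, (s k).length < (s (k + 1)).length) : ∃ x : ℕ → ℕ, ∀ k, x ∈ cyl (s k) := by
  have hmono : ∀ {k l}, k ≤ l → s k <+: s l := by
    intro k l h
    induction l, h using Nat.le_induction with
    | base => exact List.prefix_rfl
    | succ n _ ih => exact ih.trans (hs n)
  have hlen := le_length_of_lt_succ hl
  -- The default 0 is never used: `s (i + 1)` has length greater than `i`.
  refine ⟨fun i => (s (i + 1)).getD i 0, fun k => ?_⟩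
  refine List.ext_getElem (by simp) fun i h1 h2 => ?_
  have h3 : i < (s (i + 1)).length := hlen (i + 1)
  rw [getElem_initSeg, List.getD_eq_getElem _ _ h3]
  rcases le_total k (i + 1) with h | h
  · exact ((hmono h).getElem h2).symm
  · exact (hmono h).getElem h3

end InitialSegments

/-! ### Bodies of trees and restrictions to a node -/

section Bodies

lemma mem_of_mem_body {T : Descriptive.tree ℕ} {x : ℕ → ℕ} {σ : List ℕ} (hx : x ∈ body T)
    (hσ : x ∈ cyl σ) : σ ∈ T := by
  have := hx σ.length
  rwa [show initSeg x σ.length = σ from hσ] at this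

lemma body_mono {S T : Descriptive.tree ℕ} (h : S ≤ T) : body S ⊆ body T := fun _ hx n => h (hx n)

lemma isClosed_body (T : Descriptive.tree ℕ) : IsClosed (body T) := by
  rw [← isOpen_compl_iff, isOpen_iff_forall_mem_open]
  intro x hx
  simp only [Set.mem_compl_iff, body, Set.mem_ofPred_eq, not_forall] at hx
  obtain ⟨n, hn⟩ := hx
  exact ⟨cyl (initSeg x n), fun y hy hyT => hn (mem_of_mem_body hyT hy), isOpen_cyl _,
    mem_cyl_initSeg x n⟩

lemma isBorel_iff {A : Set (ℕ → ℕ)} : IsBorel A ↔ MeasurableSet A := by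
  rw [IsBorel, ← BorelSpace.measurable_eq]

lemma isBorel_body (T : Descriptive.tree ℕ) : IsBorel (body T) :=
  isBorel_iff.2 (isClosed_body T).measurableSet

/-- The tree of all initial segments of elements of `X`. -/
def treeOf (X : Set (ℕ → ℕ)) : Descriptive.tree ℕ :=
  ⟨{σ | (X ∩ cyl σ).Nonempty}, fun _ _ ⟨x, hx, hxσ⟩ =>
    ⟨x, hx, cyl_anti (List.prefix_append _ _) hxσ⟩⟩

lemma mem_treeOf {X : Set (ℕ → ℕ)} {σ : List ℕ} : σ ∈ treeOf X ↔ (X ∩ cyl σ).Nonempty := Iff.rfl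

lemma subset_body_treeOf (X : Set (ℕ → ℕ)) : X ⊆ body (treeOf X) := fun x hx n =>
  mem_treeOf.2 ⟨x, hx, mem_cyl_initSeg x n⟩

/-- The nodes of `T` that are comparable with `σ`. -/
def restr (T : Descriptive.tree ℕ) (σ : List ℕ) : Descriptive.tree ℕ :=
  ⟨{τ | τ ∈ T ∧ (τ <+: σ ∨ σ <+: τ)}, fun τ a ⟨h1, h2⟩ => by
    refine ⟨Descriptive.Tree.mem_of_append h1, ?_⟩
    rcases h2 with h2 | h2
    · exact Or.inl ((List.prefix_append _ _).trans h2)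
    · rcases List.prefix_concat_iff.1 h2 with rfl | h
      · exact Or.inl (List.prefix_append _ _)
      · exact Or.inr h⟩

lemma mem_restr {T : Descriptive.tree ℕ} {σ τ : List ℕ} :
    τ ∈ restr T σ ↔ τ ∈ T ∧ (τ <+: σ ∨ σ <+: τ) := Iff.rfl

lemma restr_le (T : Descriptive.tree ℕ) (σ : List ℕ) : restr T σ ≤ T := fun _ h => h.1

lemma mem_cyl_of_mem_body_restr {T : Descriptive.tree ℕ} {σ : List ℕ} {x : ℕ → ℕ}
    (hx : x ∈ body (restr T σ)) : x ∈ cyl σ := by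
  rcases (hx σ.length).2 with h | h
  · exact h.eq_of_length (by simp)
  · exact mem_cyl_of_prefix h

end Bodies

/-! ### Positive families and fusion -/

section Positive

/-- A family of positive sets: an upward closed family of sets with at least two elements that
contains the whole of `ω`. -/
structure IsPosFamily (P : Set (Set ℕ)) : Prop where
  mono : ∀ {A B : Set ℕ}, A ∈ P → A ⊆ B → B ∈ P
  nontrivial : ∀ {A : Set ℕ}, A ∈ P → A.Nontrivial
  univ_mem : Set.univ ∈ P

/-- The trees in which every node extends to a node with a positive set of successors. -/
def posTrees (P : Set (Set ℕ)) : Set (Descriptive.tree ℕ) :=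
  {T | [] ∈ T ∧ ∀ σ ∈ T, ∃ τ ∈ T, σ <+: τ ∧ succs T τ ∈ P}

lemma millerTrees_eq (I : Order.Ideal (Set ℕ)) : MillerTrees I = posTrees {A | A ∉ I} := rfl

lemma fullMillerTrees_eq : FullMillerTrees = posTrees {Set.univ} := by
  simp only [FullMillerTrees, posTrees, succs, Set.mem_singleton_iff, Set.eq_univ_iff_forall,
    Set.mem_ofPred_eq]

lemma isPosFamily_notMem_ideal {I : Order.Ideal (Set ℕ)} (hI : I.IsProper)
    (hfin : ∀ A : Set ℕ, A.Finite → A ∈ I) : IsPosFamily {A | A ∉ I} where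
  mono hA hAB hB := hA (I.lower hAB hB)
  nontrivial {A} hA := by
    by_contra h
    exact hA (hfin A (Set.not_nontrivial_iff.1 h).finite)
  univ_mem h := hI.ne_univ (Set.eq_univ_of_forall fun A => I.lower (Set.subset_univ A) h)

lemma isPosFamily_univ : IsPosFamily {Set.univ} where
  mono hA hAB := by
    rw [Set.mem_singleton_iff] at *
    exact Set.univ_subset_iff.1 (hA ▸ hAB)
  nontrivial hA := by
    rw [Set.mem_singleton_iff.1 hA]
    exact Set.nontrivial_univ
  univ_mem := rfl

/-- The nodes lying on a path described by a transition relation on a set of states, where each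
state `s` carries the node `nd s`, has `Sp s` as its allowed set of successors, and is followed by
the state `next s n` in the direction `n`. -/
inductive Reach {α : Type*} (nd : α → List ℕ) (Sp : α → Set ℕ) (next : α → ℕ → α) :
    α → List ℕ → Prop
  | stem {s σ} : σ <+: nd s → Reach nd Sp next s σ
  | step {s n σ} : n ∈ Sp s → Reach nd Sp next (next s n) σ → Reach nd Sp next s σ

namespace Reach

variable {α : Type*} {nd : α → List ℕ} {Sp : α → Set ℕ} {next : α → ℕ → α}

lemma of_prefix {s : α} {σ τ : List ℕ} (h : Reach nd Sp next s τ) (hσ : σ <+: τ) :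
    Reach nd Sp next s σ := by
  induction h with
  | stem h => exact .stem (hσ.trans h)
  | step hn _ ih => exact .step hn (ih hσ)

/-- Transitions only lengthen nodes, so every path leaving `s` first runs through `nd s`. -/
lemma comparable (hnd : ∀ s, ∀ n ∈ Sp s, nd s ++ [n] <+: nd (next s n)) {s : α} {σ : List ℕ}
    (h : Reach nd Sp next s σ) : σ <+: nd s ∨ nd s <+: σ := by
  induction h with
  | stem h => exact Or.inl h
  | @step s n σ hn _ ih =>
    have h1 : nd s <+: nd (next s n) := (List.prefix_append _ _).trans (hnd s n hn)
    rcases ih with h | h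
    · exact List.prefix_or_prefix_of_prefix h h1
    · exact Or.inr (h1.trans h)

lemma of_append (hnd : ∀ s, ∀ n ∈ Sp s, nd s ++ [n] <+: nd (next s n)) {s : α} {σ : List ℕ}
    {n : ℕ} (h : Reach nd Sp next s σ) (hσ : nd s ++ [n] <+: σ) :
    n ∈ Sp s ∧ Reach nd Sp next (next s n) σ := by
  cases h with
  | stem h => simpa using (hσ.trans h).length_le
  | @step _ m _ hm h =>
    have key : nd s ++ [m] = nd s ++ [n] := by
      rcases h.comparable hnd with h' | h'
      · exact (List.prefix_of_prefix_length_le (hnd s m hm) (hσ.trans h')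
          (by simp)).eq_of_length (by simp)
      · exact (List.prefix_of_prefix_length_le ((hnd s m hm).trans h') hσ
          (by simp)).eq_of_length (by simp)
    obtain rfl : m = n := by simpa using key
    exact ⟨hm, h⟩

/-- Supplies positive splitting in the fusion tree: above σ there is the node of a state `t`, from
which all directions in `Sp t` are open. -/
lemma exists_state {s : α} {σ : List ℕ} (h : Reach nd Sp next s σ) :
    ∃ t, σ <+: nd t ∧ Reach nd Sp next s (nd t) ∧
      ((∀ s, ∀ n ∈ Sp s, nd s ++ [n] <+: nd (next s n)) →
        ∀ n ∈ Sp t, Reach nd Sp next s (nd t ++ [n])) := by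
  induction h with
  | @stem s σ h => exact ⟨s, h, .stem List.prefix_rfl, fun hnd n hn => .step hn (.stem (hnd s n hn))⟩
  | step hn _ ih =>
    obtain ⟨t, h1, h2, h3⟩ := ih
    exact ⟨t, h1, .step hn h2, fun hnd m hm => .step hn (h3 hnd m hm)⟩

end Reach

variable {P : Set (Set ℕ)}

/-- Fusion: a system of states, each of which carries a node and branches to further states in
positively many directions, yields a tree all of whose branches run through states. -/
theorem exists_fusion (hP : IsPosFamily P) {α : Type*} (nd : α → List ℕ) (Rel : α → α → Prop)
    (h : ∀ s, ∃ A ∈ P, ∀ n ∈ A, ∃ s', nd s ++ [n] <+: nd s' ∧ Rel s s') (s₀ : α) :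
    ∃ S ∈ posTrees P, (∀ σ ∈ S, ∃ s, σ <+: nd s) ∧
      ∀ x ∈ body S, ∃ s : ℕ → α, s 0 = s₀ ∧ ∀ k, x ∈ cyl (nd (s k)) ∧ Rel (s k) (s (k + 1)) ∧
        (nd (s k)).length < (nd (s (k + 1))).length := by
  choose Sp hSp h using h
  -- Makes the transition total; outside `Sp s` its value is irrelevant.
  have : ∀ s n, ∃ s', n ∈ Sp s → nd s ++ [n] <+: nd s' ∧ Rel s s' := fun s n => by
    by_cases hn : n ∈ Sp s
    · obtain ⟨s', hs'⟩ := h s n hn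
      exact ⟨s', fun _ => hs'⟩
    · exact ⟨s, fun h => absurd h hn⟩
  choose next hnext using this
  have hnd : ∀ s, ∀ n ∈ Sp s, nd s ++ [n] <+: nd (next s n) := fun s n hn => (hnext s n hn).1
  let S : Descriptive.tree ℕ := ⟨{σ | Reach nd Sp next s₀ σ}, fun σ a hσ =>
    Reach.of_prefix hσ (List.prefix_append _ _)⟩
  have hS : ∀ σ, σ ∈ S ↔ Reach nd Sp next s₀ σ := fun _ => Iff.rfl
  refine ⟨S, ⟨(hS _).2 (.stem List.nil_prefix), fun σ hσ => ?_⟩, fun σ hσ => ?_, fun x hx => ?_⟩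
  · obtain ⟨t, h1, h2, h3⟩ := ((hS σ).1 hσ).exists_state
    exact ⟨nd t, (hS _).2 h2, h1, hP.mono (hSp t) fun n hn => (hS _).2 (h3 hnd n hn)⟩
  · obtain ⟨t, h1, -⟩ := ((hS σ).1 hσ).exists_state
    exact ⟨t, h1⟩
  -- A branch of the subtree at `s` passes `nd s`, leaves it in an allowed direction and stays in
  -- the subtree of the next state. Iterating this yields the sequence of states.
  · have key : ∀ s, (∀ m, Reach nd Sp next s (initSeg x m)) →
        x ∈ cyl (nd s) ∧ x (nd s).length ∈ Sp s ∧
          ∀ m, Reach nd Sp next (next s (x (nd s).length)) (initSeg x m) := by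
      intro s hs
      have hc : x ∈ cyl (nd s) := by
        rcases (hs (nd s).length).comparable hnd with h' | h'
        · exact h'.eq_of_length (by simp)
        · exact mem_cyl_of_prefix h'
      have hc' : x ∈ cyl (nd s ++ [x (nd s).length]) := mem_cyl_append.2 ⟨hc, rfl⟩
      have h1 : ∀ m, (nd s).length < m → x (nd s).length ∈ Sp s ∧
          Reach nd Sp next (next s (x (nd s).length)) (initSeg x m) := fun m hm =>
        (hs m).of_append hnd (prefix_of_mem_cyl hc' (by simpa using hm))
      refine ⟨hc, (h1 _ (Nat.lt_succ_self _)).1, fun m => ?_⟩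
      exact (h1 ((nd s).length + 1 + m) (by omega)).2.of_prefix (initSeg_prefix x (by omega))
    let s : ℕ → α := fun k => Nat.rec s₀ (fun _ t => next t (x (nd t).length)) k
    have hs : ∀ k m, Reach nd Sp next (s k) (initSeg x m) := by
      intro k
      induction k with
      | zero => exact fun m => (hS _).1 (hx m)
      | succ k ih => exact (key (s k) ih).2.2
    refine ⟨s, rfl, fun k => ?_⟩
    obtain ⟨h1, h2, -⟩ := key (s k) (hs k)
    have h3 := hnext (s k) _ h2
    exact ⟨h1, h3.2, by simpa using h3.1.length_le⟩

lemma exists_succ_of_mem (hP : IsPosFamily P) {T : Descriptive.tree ℕ} (hT : T ∈ posTrees P)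
    {σ : List ℕ} (hσ : σ ∈ T) : ∃ n, σ ++ [n] ∈ T := by
  obtain ⟨τ, -, ⟨ρ, rfl⟩, h⟩ := hT.2 σ hσ
  obtain ⟨n, hn⟩ := (hP.nontrivial h).nonempty
  rcases ρ with - | ⟨m, ρ⟩
  · exact ⟨n, by simpa [succs] using hn⟩
  · refine ⟨m, Descriptive.Tree.mem_of_prefix ?_ hn⟩
    exact ⟨ρ ++ [n], by simp⟩

lemma exists_branch (hP : IsPosFamily P) {T : Descriptive.tree ℕ} (hT : T ∈ posTrees P)
    {σ : List ℕ} (hσ : σ ∈ T) : ∃ x ∈ body T, x ∈ cyl σ := by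
  choose! f hf using fun τ (hτ : τ ∈ T) => exists_succ_of_mem hP hT hτ
  let s : ℕ → List ℕ := fun k => Nat.rec σ (fun _ τ => τ ++ [f τ]) k
  have hs : ∀ k, s k ∈ T := by
    intro k
    induction k with
    | zero => exact hσ
    | succ k ih => exact hf _ ih
  have hl : ∀ k, (s k).length = σ.length + k := by
    intro k
    induction k with
    | zero => rfl
    | succ k ih =>
      change (s k ++ [f (s k)]).length = _
      simp [ih, add_assoc]
  obtain ⟨x, hx⟩ := exists_mem_cyl_of_chain s (fun k => List.prefix_append _ _)
    (fun k => by simp only [hl]; omega)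
  exact ⟨x, fun n => Descriptive.Tree.mem_of_prefix
    (prefix_total_of_mem_cyl (mem_cyl_initSeg x n) (hx n) (by simp [hl])) (hs n), hx 0⟩

lemma body_nonempty (hP : IsPosFamily P) {T : Descriptive.tree ℕ} (hT : T ∈ posTrees P) :
    (body T).Nonempty := by
  obtain ⟨x, hx, -⟩ := exists_branch hP hT hT.1
  exact ⟨x, hx⟩

/-- Every node of `S` lies on a branch, so the body determines the tree. -/
lemma le_of_body_subset (hP : IsPosFamily P) {S T : Descriptive.tree ℕ} (hS : S ∈ posTrees P)
    (h : body S ⊆ body T) : S ≤ T := fun σ hσ => by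
  obtain ⟨x, hx, hxσ⟩ := exists_branch hP hS hσ
  exact mem_of_mem_body (h hx) hxσ

lemma restr_mem_posTrees {T : Descriptive.tree ℕ} (hT : T ∈ posTrees P) {σ : List ℕ}
    (hσ : σ ∈ T) : restr T σ ∈ posTrees P := by
  refine ⟨mem_restr.2 ⟨hT.1, Or.inl List.nil_prefix⟩, fun τ hτ => ?_⟩
  have key : ∀ ρ ∈ T, σ <+: ρ → ∃ τ' ∈ restr T σ, ρ <+: τ' ∧ succs (restr T σ) τ' ∈ P := by
    intro ρ hρ hσρ
    obtain ⟨τ', h1, h2, h3⟩ := hT.2 ρ hρ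
    refine ⟨τ', mem_restr.2 ⟨h1, Or.inr (hσρ.trans h2)⟩, h2, ?_⟩
    convert h3 using 1
    ext n
    simp only [succs, Set.mem_ofPred_eq, mem_restr, and_iff_left_iff_imp]
    exact fun _ => Or.inr (hσρ.trans (h2.trans (List.prefix_append _ _)))
  rcases hτ.2 with h | h
  · obtain ⟨τ', h1, h2, h3⟩ := key σ hσ List.prefix_rfl
    exact ⟨τ', h1, h.trans h2, h3⟩
  · exact key τ hτ.1 h

lemma top_mem_posTrees (hP : IsPosFamily P) : (⊤ : Descriptive.tree ℕ) ∈ posTrees P := by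
  have h : ∀ σ, σ ∈ (⊤ : Descriptive.tree ℕ) := fun _ => trivial
  refine ⟨h _, fun σ _ => ⟨σ, h _, List.prefix_rfl, ?_⟩⟩
  exact hP.mono hP.univ_mem fun n _ => h (σ ++ [n])

lemma below_top (𝕋 : Set (Descriptive.tree ℕ)) : below 𝕋 ⊤ = 𝕋 := by
  simp [below]

end Positive

/-! ### Negligible sets and the dichotomy for analytic sets -/

section Negligible

variable {P : Set (Set ℕ)}

/-- A set is negligible if it is covered by countably many bodies of trees without positively
splitting nodes. -/
def Negligible (P : Set (Set ℕ)) (X : Set (ℕ → ℕ)) : Prop :=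
  ∃ K : ℕ → Descriptive.tree ℕ, (∀ n σ, succs (K n) σ ∉ P) ∧ X ⊆ ⋃ n, body (K n)

lemma Negligible.mono {X Y : Set (ℕ → ℕ)} (hY : Negligible P Y) (h : X ⊆ Y) : Negligible P X := by
  obtain ⟨K, h1, h2⟩ := hY
  exact ⟨K, h1, h.trans h2⟩

lemma Negligible.iUnion {ι : Type*} [Countable ι] [Nonempty ι] {X : ι → Set (ℕ → ℕ)}
    (h : ∀ i, Negligible P (X i)) : Negligible P (⋃ i, X i) := by
  choose K h1 h2 using h
  obtain ⟨e, he⟩ := exists_surjective_nat (ι × ℕ)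
  refine ⟨fun n => K (e n).1 (e n).2, fun n σ => h1 _ _ _, Set.iUnion_subset fun i x hx => ?_⟩
  obtain ⟨m, hm⟩ := Set.mem_iUnion.1 (h2 i hx)
  obtain ⟨n, hn⟩ := he (i, m)
  exact Set.mem_iUnion.2 ⟨n, by simpa only [hn] using hm⟩

lemma Negligible.union {X Y : Set (ℕ → ℕ)} (hX : Negligible P X) (hY : Negligible P Y) :
    Negligible P (X ∪ Y) := by
  rw [Set.union_eq_iUnion]
  exact .iUnion (Bool.forall_bool.2 ⟨hY, hX⟩)

lemma negligible_body {K : Descriptive.tree ℕ} (hK : ∀ σ, succs K σ ∉ P) :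
    Negligible P (body K) :=
  ⟨fun _ => K, fun _ => hK, Set.subset_iUnion (fun _ : ℕ => body K) 0⟩

/-- A non-negligible subset of a basic clopen set has a positively splitting node beyond the stem. -/
lemma exists_pos_of_not_negligible (hP : IsPosFamily P) {X : Set (ℕ → ℕ)} (hX : ¬ Negligible P X)
    {σ : List ℕ} (hσ : X ⊆ cyl σ) :
    ∃ τ, σ <+: τ ∧ {n | (X ∩ cyl (τ ++ [n])).Nonempty} ∈ P := by
  by_contra! h
  refine hX ((negligible_body (K := treeOf X) fun τ hτ => ?_).mono (subset_body_treeOf X))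
  obtain ⟨m, ⟨x, hx, hxm⟩, n, ⟨y, hy, hyn⟩, hmn⟩ := hP.nontrivial hτ
  -- All points of `X` follow σ up to its length, so a node with two successors cannot be a proper
  -- initial segment of σ.
  refine h τ ?_ hτ
  have hxτ := (mem_cyl_append.1 hxm).1
  by_contra hστ
  have hlt : τ.length < σ.length := by
    by_contra hle
    exact hστ (prefix_total_of_mem_cyl (hσ hx) hxτ (not_lt.1 hle))
  have e : τ ++ [m] = τ ++ [n] := by
    refine (List.prefix_of_prefix_length_le (l₃ := σ) ?_ ?_ (by simp)).eq_of_length (by simp)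
    · exact prefix_total_of_mem_cyl hxm (hσ hx) (by simpa using hlt)
    · exact prefix_total_of_mem_cyl hyn (hσ hy) (by simpa using hlt)
  exact hmn (by simpa using e)

/-- An analytic set is negligible or contains the body of a tree. -/
theorem negligible_or_containsBody (hP : IsPosFamily P) {X : Set (ℕ → ℕ)}
    (hX : MeasureTheory.AnalyticSet X) : Negligible P X ∨ ContainsBody (posTrees P) X := by
  rw [MeasureTheory.AnalyticSet] at hX
  rcases hX with rfl | ⟨f, hf, rfl⟩
  · exact Or.inl ⟨fun _ => ⊥, fun n σ h => (hP.nontrivial h).nonempty.ne_empty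
      (Set.eq_empty_of_forall_notMem fun _ h => h), Set.empty_subset _⟩
  by_cases hneg : Negligible P (Set.range f)
  · exact Or.inl hneg
  refine Or.inr ?_
  -- The kernel of `f`: points all of whose neighbourhoods have non-negligible image. Its complement
  -- is a countable union of cylinders with negligible image, so discarding it costs nothing.
  let F : Set (ℕ → ℕ) := {y | ∀ k, ¬ Negligible P (f '' cyl (initSeg y k))}
  have hF : ∀ u, ¬ Negligible P (f '' cyl u) → ¬ Negligible P (f '' (F ∩ cyl u)) := by
    intro u hu hFu
    apply hu
    have hrest : Negligible P
        (⋃ v : List ℕ, {z | Negligible P (f '' cyl v) ∧ z ∈ f '' cyl v}) := by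
      refine .iUnion fun v => ?_
      by_cases hv : Negligible P (f '' cyl v)
      · exact hv.mono fun z hz => hz.2
      · exact hFu.mono fun z hz => absurd hz.1 hv
    refine (hFu.union hrest).mono ?_
    rintro _ ⟨y, hy, rfl⟩
    by_cases hyF : y ∈ F
    · exact Or.inl ⟨y, ⟨hyF, hy⟩, rfl⟩
    · simp only [F, Set.mem_ofPred_eq, not_forall, not_not] at hyF
      obtain ⟨k, hk⟩ := hyF
      exact Or.inr (Set.mem_iUnion.2 ⟨initSeg y k, hk, y, mem_cyl_initSeg y k, rfl⟩)
  -- A state pairs a node τ in the target with a node `u` in the domain, such that points of `F`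
  -- through `u` are mapped beyond τ in positively many directions.
  let α := {p : List ℕ × List ℕ // {n | (f '' (F ∩ cyl p.2) ∩ cyl (p.1 ++ [n])).Nonempty} ∈ P}
  have hnil : ∀ x, x ∈ cyl [] := fun _ => rfl
  obtain ⟨τ₀, -, hτ₀⟩ := exists_pos_of_not_negligible hP
    (hF [] (by rwa [Set.eq_univ_of_forall hnil, Set.image_univ])) (fun x _ => hnil x)
  let Rel : α → α → Prop := fun p q =>
    p.1.2 <+: q.1.2 ∧ p.1.2.length < q.1.2.length ∧ f '' cyl q.1.2 ⊆ cyl p.1.1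
  have hstep : ∀ p : α, ∃ A ∈ P, ∀ n ∈ A, ∃ q : α, p.1.1 ++ [n] <+: q.1.1 ∧ Rel p q := by
    refine fun p => ⟨_, p.2, ?_⟩
    rintro n ⟨_, ⟨y, ⟨hyF, hyu⟩, rfl⟩, hyn⟩
    obtain ⟨k, hk⟩ := exists_cyl_subset ((isOpen_cyl (p.1.1 ++ [n])).preimage hf) hyn
    -- Long enough for continuity to confine the image, and strictly longer than the old domain
    -- node.
    set l := max k (p.1.2.length + 1)
    have hsub : f '' cyl (initSeg y l) ⊆ cyl (p.1.1 ++ [n]) :=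
      Set.image_subset_iff.2 (hk l (le_max_left _ _))
    obtain ⟨τ, h1, h2⟩ := exists_pos_of_not_negligible hP (hF _ (hyF l))
      ((Set.image_mono Set.inter_subset_right).trans hsub)
    have hl : p.1.2.length + 1 ≤ l := le_max_right _ _
    exact ⟨⟨(τ, initSeg y l), h2⟩, h1, prefix_of_mem_cyl hyu (by omega),
      by simpa using hl, hsub.trans (cyl_anti (List.prefix_append _ _))⟩
  obtain ⟨S, hS, -, hbody⟩ := exists_fusion hP (fun p : α => p.1.1) Rel hstep ⟨(τ₀, []), hτ₀⟩
  refine ⟨S, hS, fun x hx => ?_⟩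
  obtain ⟨s, -, hs⟩ := hbody x hx
  -- The domain nodes along a branch converge to a preimage of it.
  obtain ⟨y, hy⟩ := exists_mem_cyl_of_chain (fun k => (s k).1.2) (fun k => (hs k).2.1.1)
    (fun k => (hs k).2.1.2.1)
  refine ⟨y, eq_of_forall_exists_cyl fun m => ?_⟩
  exact ⟨(s (m + 1)).1.1, le_length_of_lt_succ (s := fun k => (s k).1.1) (fun k => (hs k).2.2) _,
    (hs (m + 1)).2.1.2.2 ⟨y, hy (m + 2), rfl⟩, (hs (m + 1)).1⟩

lemma IsBorel.negligible (hP : IsPosFamily P) {X : Set (ℕ → ℕ)} (hX : IsBorel X)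
    (h : ¬ ContainsBody (posTrees P) X) : Negligible P X :=
  (negligible_or_containsBody hP (isBorel_iff.1 hX).analyticSet).resolve_right h

/-- Negligible sets belong to the tree ideal. -/
theorem Negligible.mem_treeIdeal (hP : IsPosFamily P) {X : Set (ℕ → ℕ)} (hX : Negligible P X) :
    X ∈ treeIdeal (posTrees P) := by
  intro T hT
  obtain ⟨K, hK, hXK⟩ := hX
  obtain ⟨τ₀, h₀, -, h₀'⟩ := hT.2 [] hT.1
  -- The second coordinate counts steps; at step `k` the fusion leaves the tree `K k`.
  let α := {p : List ℕ × ℕ // p.1 ∈ T ∧ succs T p.1 ∈ P}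
  let Rel : α → α → Prop := fun p q => q.1.2 = p.1.2 + 1 ∧ q.1.1 ∉ K p.1.2
  have hstep : ∀ p : α, ∃ A ∈ P, ∀ n ∈ A, ∃ q : α, p.1.1 ++ [n] <+: q.1.1 ∧ Rel p q := by
    refine fun p => ⟨_, p.2.2, fun n hn => ?_⟩
    obtain ⟨τ, hτ, hle, hpos⟩ := hT.2 _ hn
    -- The successors of τ in `T` form a positive set and those in `K` do not, so by upward closure
    -- some direction leaves `K`.
    have : ∃ m, τ ++ [m] ∈ T ∧ τ ++ [m] ∉ K p.1.2 := by
      by_contra! h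
      exact hK p.1.2 τ (hP.mono hpos h)
    obtain ⟨m, hm, hmK⟩ := this
    obtain ⟨ρ, hρ, hle', hpos'⟩ := hT.2 _ hm
    exact ⟨⟨(ρ, p.1.2 + 1), hρ, hpos'⟩, hle.trans ((List.prefix_append _ _).trans hle'), rfl,
      fun h => hmK (Descriptive.Tree.mem_of_prefix hle' h)⟩
  obtain ⟨S, hS, hST, hbody⟩ :=
    exists_fusion hP (fun p : α => p.1.1) Rel hstep ⟨(τ₀, 0), h₀, h₀'⟩
  refine ⟨S, hS, fun σ hσ => ?_, Set.eq_empty_of_forall_notMem fun x ⟨hxS, hxX⟩ => ?_⟩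
  · obtain ⟨p, hp⟩ := hST σ hσ
    exact Descriptive.Tree.mem_of_prefix hp p.2.1
  · obtain ⟨s, hs₀, hs⟩ := hbody x hxS
    obtain ⟨n, hn⟩ := Set.mem_iUnion.1 (hXK hxX)
    have hc : ∀ k, (s k).1.2 = k := by
      intro k
      induction k with
      | zero => rw [hs₀]
      | succ k ih => rw [(hs k).2.1.1, ih]
    have h1 := (hs n).2.1.2
    rw [hc] at h1
    exact h1 (mem_of_mem_body hn (hs (n + 1)).1)

end Negligible

/-! ### The Borel part and the cardinal invariants -/

section Cardinals

variable {P : Set (Set ℕ)}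

lemma not_containsBody_of_mem_treeIdeal (hP : IsPosFamily P) {T : Descriptive.tree ℕ}
    {X : Set (ℕ → ℕ)} (hX : X ∈ treeIdeal (below (posTrees P) T)) :
    ¬ ContainsBody (posTrees P) (X ∩ body T) := by
  rintro ⟨S, hS, hSX⟩
  obtain ⟨S', hS', hle, hdisj⟩ :=
    hX S ⟨hS, le_of_body_subset hP hS (hSX.trans Set.inter_subset_right)⟩
  obtain ⟨x, hx⟩ := body_nonempty hP hS'.1
  exact Set.eq_empty_iff_forall_notMem.1 hdisj x ⟨hx, (hSX (body_mono hle hx)).1⟩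

/-- Trees below `T` control a set only inside `[T]`. There a Borel member of the ideal contains no
body, so the dichotomy applies. -/
lemma negligible_of_mem_borelPart_below (hP : IsPosFamily P) {T : Descriptive.tree ℕ}
    {X : Set (ℕ → ℕ)} (hX : X ∈ borelPart (below (posTrees P) T)) :
    Negligible P (X ∩ body T) := by
  obtain ⟨N, hN, hXN⟩ := hX
  have : Negligible P (⋃ n, N n ∩ body T) := .iUnion fun n =>
    IsBorel.negligible hP
      (isBorel_iff.2 ((isBorel_iff.1 (hN n).2).inter (isClosed_body T).measurableSet))
      (not_containsBody_of_mem_treeIdeal hP (hN n).1)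
  refine this.mono ?_
  rw [← Set.iUnion_inter]
  exact Set.inter_subset_inter_left _ hXN

/-- The Borel part of the tree ideal consists of the negligible sets. -/
theorem mem_borelPart_iff (hP : IsPosFamily P) {X : Set (ℕ → ℕ)} :
    X ∈ borelPart (posTrees P) ↔ Negligible P X := by
  constructor
  · intro h
    rw [← below_top (posTrees P)] at h
    exact (negligible_of_mem_borelPart_below hP h).mono fun x hx => ⟨hx, fun _ => trivial⟩
  · rintro ⟨K, hK, hX⟩
    exact ⟨fun n => body (K n), fun n =>
      ⟨(negligible_body (hK n)).mem_treeIdeal hP, isBorel_body _⟩, hX⟩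

lemma not_negligible_body (hP : IsPosFamily P) {T : Descriptive.tree ℕ} (hT : T ∈ posTrees P) :
    ¬ Negligible P (body T) := fun h => by
  obtain ⟨S, hS, hle, hdisj⟩ := h.mem_treeIdeal hP T hT
  obtain ⟨x, hx⟩ := body_nonempty hP hS
  exact Set.eq_empty_iff_forall_notMem.1 hdisj x ⟨hx, body_mono hle hx⟩

lemma negligible_singleton (hP : IsPosFamily P) (x : ℕ → ℕ) : Negligible P {x} := by
  refine (negligible_body (K := treeOf {x}) fun τ hτ => ?_).mono (subset_body_treeOf _)
  obtain ⟨m, ⟨y, rfl, hym⟩, n, ⟨z, rfl, hzn⟩, hmn⟩ := hP.nontrivial hτ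
  exact hmn ((mem_cyl_append.1 hym).2.symm.trans (mem_cyl_append.1 hzn).2)

lemma borelPart_subset_borelPart_below {𝕋 : Set (Descriptive.tree ℕ)} (T : Descriptive.tree ℕ) :
    borelPart 𝕋 ⊆ borelPart (below 𝕋 T) := by
  rintro X ⟨N, hN, hX⟩
  refine ⟨N, fun n => ⟨fun S hS => ?_, (hN n).2⟩, hX⟩
  obtain ⟨S', h1, h2, h3⟩ := (hN n).1 S hS.1
  exact ⟨S', ⟨h1, h2.trans hS.2⟩, h2, h3⟩

lemma cov_le {J A : Set (Set (ℕ → ℕ))} (hA : A ⊆ J) (h : ⋃₀ A = Set.univ) : cov J ≤ #A :=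
  csInf_le' ⟨A, hA, h, rfl⟩

lemma covH_le {J A : Set (Set (ℕ → ℕ))} (hA : A ⊆ J) {B : Set (ℕ → ℕ)} (hB : IsBorel B)
    (hBJ : B ∉ J) (h : B ⊆ ⋃₀ A) : covH J ≤ #A :=
  csInf_le' ⟨A, hA, ⟨B, hB, hBJ, h⟩, rfl⟩

lemma shrinkNum_le {𝕋 : Set (Descriptive.tree ℕ)} {A : Set (Set (ℕ → ℕ))} (hA : A ⊆ borelPart 𝕋)
    (h : ∀ T ∈ 𝕋, (⋃₀ A ∩ body T).Nonempty) : shrinkNum 𝕋 ≤ #A :=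
  csInf_le' ⟨A, hA, h, rfl⟩

lemma shrinkNumH_le {𝕋 : Set (Descriptive.tree ℕ)} {T : Descriptive.tree ℕ} (hT : T ∈ 𝕋) :
    shrinkNumH 𝕋 ≤ shrinkNum (below 𝕋 T) :=
  csInf_le' ⟨T, hT, rfl⟩

/-- Singletons are negligible, so covers exist and the infimum is a genuine minimum rather than the
default 0. -/
lemma cov_attained (hP : IsPosFamily P) : ∃ A ⊆ borelPart (posTrees P),
    ⋃₀ A = Set.univ ∧ #A = cov (borelPart (posTrees P)) := by
  refine csInf_mem (s := {κ | ∃ A : Set (Set (ℕ → ℕ)), A ⊆ borelPart (posTrees P) ∧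
    ⋃₀ A = Set.univ ∧ #A = κ}) ⟨_, Set.range (fun x : ℕ → ℕ => ({x} : Set (ℕ → ℕ))), ?_, ?_, rfl⟩
  · rintro _ ⟨x, rfl⟩
    exact (mem_borelPart_iff hP).2 (negligible_singleton hP x)
  · exact Set.eq_univ_of_forall fun x => ⟨{x}, ⟨x, rfl⟩, rfl⟩

lemma covH_attained (hP : IsPosFamily P) : ∃ A ⊆ borelPart (posTrees P),
    (∃ B, IsBorel B ∧ B ∉ borelPart (posTrees P) ∧ B ⊆ ⋃₀ A) ∧
      #A = covH (borelPart (posTrees P)) := by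
  obtain ⟨A, hA, hA', -⟩ := cov_attained hP
  refine csInf_mem (s := {κ | ∃ A : Set (Set (ℕ → ℕ)), A ⊆ borelPart (posTrees P) ∧
    (∃ B, IsBorel B ∧ B ∉ borelPart (posTrees P) ∧ B ⊆ ⋃₀ A) ∧ #A = κ})
    ⟨_, A, hA, ⟨body ⊤, isBorel_body _, fun h => ?_, hA' ▸ Set.subset_univ _⟩, rfl⟩
  exact not_negligible_body hP (top_mem_posTrees hP) ((mem_borelPart_iff hP).1 h)

lemma shrinkNum_below_attained (hP : IsPosFamily P) (T : Descriptive.tree ℕ) :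
    ∃ A ⊆ borelPart (below (posTrees P) T),
      (∀ S ∈ below (posTrees P) T, (⋃₀ A ∩ body S).Nonempty) ∧
        #A = shrinkNum (below (posTrees P) T) := by
  obtain ⟨A, hA, hA', -⟩ := cov_attained hP
  refine csInf_mem (s := {κ | ∃ A : Set (Set (ℕ → ℕ)), A ⊆ borelPart (below (posTrees P) T) ∧
    (∀ S ∈ below (posTrees P) T, (⋃₀ A ∩ body S).Nonempty) ∧ #A = κ})
    ⟨_, A, hA.trans (borelPart_subset_borelPart_below T), fun S hS => ?_, rfl⟩
  rw [hA', Set.univ_inter]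
  exact body_nonempty hP hS.1

lemma exists_dominating {A : Set (Set (ℕ → ℕ))} (hA : #A < boundingNumber)
    (f : Set (ℕ → ℕ) → ℕ → ℕ) : ∃ g : ℕ → ℕ, ∀ X ∈ A, ∀ᶠ n in atTop, f X n ≤ g n := by
  by_contra h
  refine (mk_image_le (f := f) (s := A)).not_gt (hA.trans_le (csInf_le' ⟨f '' A, ?_, rfl⟩))
  rintro ⟨g, hg⟩
  exact h ⟨g, fun X hX => hg _ ⟨X, hX, rfl⟩⟩

/-! ### From meeting all trees to covering a body -/

/-- If fewer than `𝔟` sets of the Borel part meet every tree below `T`, then no more sets of the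
Borel part cover the body of some tree. -/
theorem exists_body_subset_sUnion (hP : IsPosFamily P) {T : Descriptive.tree ℕ}
    (hT : T ∈ posTrees P) {A : Set (Set (ℕ → ℕ))} (hA : A ⊆ borelPart (below (posTrees P) T))
    (hmeet : ∀ S ∈ below (posTrees P) T, (⋃₀ A ∩ body S).Nonempty) (hb : #A < boundingNumber) :
    ∃ S ∈ posTrees P, ∃ B ⊆ borelPart (posTrees P), body S ⊆ ⋃₀ B ∧ #B ≤ #A := by
  by_contra! hcov
  choose! K hK hAK using fun X (hX : X ∈ A) => negligible_of_mem_borelPart_below hP (hA hX)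
  have hx : ∀ σ ∈ T, ∃ x ∈ body T, x ∈ cyl σ ∧ ∀ X ∈ A, ∀ n, x ∉ body (K X n) := fun σ hσ => by
    -- The covers of the members of `A` form at most `#A` negligible sets, which by assumption
    -- cannot cover this body.
    have h1 : ¬ body (restr T σ) ⊆ ⋃₀ ((fun X => ⋃ n, body (K X n)) '' A) := fun h =>
      (hcov _ (restr_mem_posTrees hT hσ) _ (by
        rintro _ ⟨X, hX, rfl⟩
        exact (mem_borelPart_iff hP).2 ⟨K X, hK X hX, subset_rfl⟩) h).not_ge mk_image_le
    obtain ⟨x, hx, hxA⟩ := Set.not_subset.1 h1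
    exact ⟨x, body_mono (restr_le T σ) hx, mem_cyl_of_mem_body_restr hx, fun X hX n hn =>
      hxA ⟨_, ⟨X, hX, rfl⟩, Set.mem_iUnion.2 ⟨n, hn⟩⟩⟩
  choose! x hxT hxσ hxA using hx
  have hexit : ∀ X σ n, ∃ m, X ∈ A → σ ∈ T → initSeg (x σ) m ∉ K X n := fun X σ n => by
    by_cases h : X ∈ A ∧ σ ∈ T
    · have := hxA σ h.2 X h.1 n
      simp only [body, Set.mem_ofPred_eq, not_forall] at this
      obtain ⟨m, hm⟩ := this
      exact ⟨m, fun _ _ => hm⟩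
    · exact ⟨0, fun h1 h2 => absurd ⟨h1, h2⟩ h⟩
  choose e he using hexit
  -- Summing over `n ≤ i` lets a single value bound the exit times from the first `i + 1` pieces at
  -- once, so one function per `X` is enough.
  obtain ⟨g, hg⟩ := exists_dominating hb fun X i =>
    ∑ n ∈ Finset.range (i + 1), e X (Denumerable.ofNat (List ℕ) i) n
  let α := {τ : List ℕ // τ ∈ T ∧ succs T τ ∈ P}
  let Rel : α → α → Prop := fun τ τ' => ∃ n, τ.1 ++ [n] ∈ T ∧ τ.1 ++ [n] <+: τ'.1 ∧
    initSeg (x (τ.1 ++ [n])) (g (Encodable.encode (τ.1 ++ [n]))) <+: τ'.1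
  have hstep : ∀ τ : α, ∃ A ∈ P, ∀ n ∈ A, ∃ τ' : α, τ.1 ++ [n] <+: τ'.1 ∧ Rel τ τ' := by
    refine fun τ => ⟨_, τ.2.2, fun n hn => ?_⟩
    set σ := τ.1 ++ [n]
    -- Follow `x σ` up to level `g`, but at least to the end of σ, before the next positive
    -- splitting.
    obtain ⟨τ', h1, h2, h3⟩ := hT.2 _ (hxT σ hn (max (g (Encodable.encode σ)) σ.length))
    have h4 : σ <+: τ' := (prefix_of_mem_cyl (hxσ σ hn) (le_max_right _ _)).trans h2
    exact ⟨⟨τ', h1, h3⟩, h4, n, hn, h4, (initSeg_prefix _ (le_max_left _ _)).trans h2⟩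
  obtain ⟨τ₀, h₀, -, h₀'⟩ := hT.2 [] hT.1
  obtain ⟨S, hS, hST, hbody⟩ := exists_fusion hP (fun τ : α => τ.1) Rel hstep ⟨τ₀, h₀, h₀'⟩
  have hle : S ≤ T := fun σ hσ => by
    obtain ⟨p, hp⟩ := hST σ hσ
    exact Descriptive.Tree.mem_of_prefix hp p.2.1
  obtain ⟨z, ⟨X, hX, hzX⟩, hzS⟩ := hmeet S ⟨hS, hle⟩
  obtain ⟨n, hn⟩ := Set.mem_iUnion.1 (hAK X hX ⟨hzX, body_mono hle hzS⟩)
  obtain ⟨s, -, hs⟩ := hbody z hzS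
  choose hcyl hrel hlen using hs
  choose i hiT hi hix using hrel
  have hmono : StrictMono fun k => (s k).1.length := strictMono_nat_of_lt_succ hlen
  have hinj : Function.Injective fun k => Encodable.encode ((s k).1 ++ [i k]) := by
    intro k l hkl
    have := congrArg List.length (Encodable.encode_injective hkl)
    simp only [List.length_append, List.length_singleton, Nat.add_right_cancel_iff] at this
    exact hmono.injective this
  -- The codes along the branch are distinct, so eventually they lie where `g` dominates and are at
  -- least `n`. Then `z` follows `x σ` past its exit from `K X n`.
  obtain ⟨k, hk1, hk2⟩ := ((hinj.nat_tendsto_atTop.eventually (hg X hX)).and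
    (hinj.nat_tendsto_atTop.eventually (eventually_ge_atTop n))).exists
  rw [Denumerable.ofNat_encode] at hk1
  have hk3 := (Finset.single_le_sum (f := fun n => e X ((s k).1 ++ [i k]) n)
    (fun _ _ => Nat.zero_le _) (Finset.mem_range_succ_iff.2 hk2)).trans hk1
  exact he X _ n hX (hiT k) (mem_of_mem_body hn
    (cyl_anti ((initSeg_prefix _ hk3).trans (hix k)) (hcyl (k + 1))))

theorem min_le_shrinkNumH (hP : IsPosFamily P) :
    min boundingNumber (covH (borelPart (posTrees P))) ≤ shrinkNumH (posTrees P) := by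
  refine le_csInf ⟨_, ⊤, top_mem_posTrees hP, rfl⟩ ?_
  rintro _ ⟨T, hT, rfl⟩
  obtain ⟨A, hA, hmeet, hcard⟩ := shrinkNum_below_attained hP T
  rw [← hcard, min_le_iff, or_iff_not_imp_left, not_le]
  intro hb
  obtain ⟨S, hS, B, hB, hSB, hBA⟩ := exists_body_subset_sUnion hP hT hA hmeet hb
  refine (covH_le hB (isBorel_body S) (fun h => ?_) hSB).trans hBA
  exact not_negligible_body hP hS ((mem_borelPart_iff hP).1 h)

/-- By the dichotomy the covered Borel set contains some `[T]`, so the cover meets every tree below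
`T`. -/
theorem shrinkNumH_le_covH (hP : IsPosFamily P) :
    shrinkNumH (posTrees P) ≤ covH (borelPart (posTrees P)) := by
  obtain ⟨A, hA, ⟨B, hB, hBJ, hBA⟩, hcard⟩ := covH_attained hP
  rw [mem_borelPart_iff hP] at hBJ
  obtain ⟨T, hT, hTB⟩ : ContainsBody (posTrees P) B := by
    by_contra h
    exact hBJ (hB.negligible hP h)
  refine ((shrinkNumH_le hT).trans
    (shrinkNum_le (hA.trans (borelPart_subset_borelPart_below T)) fun S hS => ?_)).trans hcard.le
  obtain ⟨x, hx⟩ := body_nonempty hP hS.1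
  exact ⟨x, hBA (hTB (body_mono hS.2 hx)), hx⟩

theorem shrinkNum_le_cov (hP : IsPosFamily P) :
    shrinkNum (posTrees P) ≤ cov (borelPart (posTrees P)) := by
  obtain ⟨A, hA, hA', hcard⟩ := cov_attained hP
  refine (shrinkNum_le hA fun S hS => ?_).trans hcard.le
  rw [hA', Set.univ_inter]
  exact body_nonempty hP hS

/-! ### Transfer to the whole space and homogeneity -/

/-- The preimage of a closed piece is Borel. If it contained a body, its image would put a body
inside a negligible set. -/
lemma negligible_preimage (hP : IsPosFamily P) {h : (ℕ → ℕ) → ℕ → ℕ} (hc : Continuous h)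
    (hh : ∀ X, ContainsBody (posTrees P) X → ContainsBody (posTrees P) (h '' X))
    {X : Set (ℕ → ℕ)} (hX : Negligible P X) : Negligible P (h ⁻¹' X) := by
  obtain ⟨K, hK, hXK⟩ := hX
  have : Negligible P (⋃ n, h ⁻¹' body (K n)) := .iUnion fun n => by
    refine IsBorel.negligible hP (isBorel_iff.2 ((isClosed_body _).preimage hc).measurableSet) ?_
    intro hb
    obtain ⟨S, hS, hSK⟩ := hh _ hb
    exact not_negligible_body hP hS ((negligible_body (hK n)).mono
      (hSK.trans (Set.image_preimage_subset _ _)))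
  exact this.mono ((Set.preimage_mono hXK).trans (Set.preimage_iUnion).subset)

/-- Of homogeneity only continuity and one direction of the equivalence are needed: pulling back a
cover of `[S]` covers the whole space. -/
theorem min_le_shrinkNum (hP : IsPosFamily P)
    (hom : ∀ T ∈ posTrees P, ∃ h : (ℕ → ℕ) → ℕ → ℕ, Continuous h ∧ (∀ x, h x ∈ body T) ∧
      ∀ X, ContainsBody (posTrees P) X → ContainsBody (posTrees P) (h '' X)) :
    min boundingNumber (cov (borelPart (posTrees P))) ≤ shrinkNum (posTrees P) := by
  obtain ⟨A, hA, hmeet, hcard⟩ := shrinkNum_below_attained hP ⊤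
  rw [below_top] at hcard
  rw [← hcard, min_le_iff, or_iff_not_imp_left, not_le]
  intro hb
  obtain ⟨S, hS, B, hB, hSB, hBA⟩ :=
    exists_body_subset_sUnion hP (top_mem_posTrees hP) hA hmeet hb
  obtain ⟨h, hc, hhS, hh⟩ := hom S hS
  refine (cov_le (A := (h ⁻¹' ·) '' B) ?_ ?_).trans (mk_image_le.trans hBA)
  · rintro _ ⟨X, hX, rfl⟩
    exact (mem_borelPart_iff hP).2
      (negligible_preimage hP hc hh ((mem_borelPart_iff hP).1 (hB hX)))
  · refine Set.eq_univ_of_forall fun x => ?_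
    obtain ⟨X, hX, hxX⟩ := hSB (hhS x)
    exact ⟨_, ⟨X, hX, rfl⟩, hxX⟩

lemma Homogeneous.exists_continuous {𝕋 : Set (Descriptive.tree ℕ)} (h𝕋 : Homogeneous 𝕋)
    {T : Descriptive.tree ℕ} (hT : T ∈ 𝕋) : ∃ h : (ℕ → ℕ) → ℕ → ℕ, Continuous h ∧
      (∀ x, h x ∈ body T) ∧ ∀ X, ContainsBody 𝕋 X → ContainsBody 𝕋 (h '' X) := by
  obtain ⟨h, hh⟩ := h𝕋 T hT
  exact ⟨fun x => h x, continuous_subtype_val.comp h.continuous, fun x => (h x).2,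
    fun X => (hh X).1⟩

/-- The whole space embeds into the body of a full-splitting Miller tree so that images of bodies
contain bodies. -/
lemma exists_continuous_of_mem_full {T : Descriptive.tree ℕ} (hT : T ∈ posTrees {Set.univ}) :
    ∃ h : (ℕ → ℕ) → ℕ → ℕ, Continuous h ∧ (∀ x, h x ∈ body T) ∧
      ∀ X, ContainsBody (posTrees {Set.univ}) X → ContainsBody (posTrees {Set.univ}) (h '' X) := by
  choose! e heT hle hfull using hT.2
  have hsucc : ∀ σ ∈ T, ∀ n, e σ ++ [n] ∈ T := fun σ hσ n =>
    Set.eq_univ_iff_forall.1 (hfull σ hσ) n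
  -- Copies the full tree into `T`: from a full-splitting node, step in direction `n`, then move up
  -- to the next full-splitting node.
  let φ : List ℕ → List ℕ := fun w => w.foldl (fun τ n => e (τ ++ [n])) (e [])
  have hφ_append : ∀ w n, φ (w ++ [n]) = e (φ w ++ [n]) := fun w n => by
    simp [φ, List.foldl_append]
  have hφ : ∀ w, ∃ σ ∈ T, φ w = e σ := fun w => by
    induction w using List.reverseRecOn with
    | nil => exact ⟨[], hT.1, rfl⟩
    | append_singleton w n ih =>
      obtain ⟨σ, hσ, h⟩ := ih
      exact ⟨φ w ++ [n], h ▸ hsucc σ hσ n, hφ_append w n⟩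
  have hφT : ∀ w, φ w ∈ T := fun w => by
    obtain ⟨σ, hσ, h⟩ := hφ w
    exact h ▸ heT σ hσ
  have hφ_step : ∀ w n, φ w ++ [n] <+: φ (w ++ [n]) := fun w n => by
    obtain ⟨σ, hσ, h⟩ := hφ w
    rw [hφ_append]
    exact hle _ (h ▸ hsucc σ hσ n)
  have hφ_mono : ∀ {v w}, v <+: w → φ v <+: φ w := by
    rintro v _ ⟨u, rfl⟩
    induction u using List.reverseRecOn with
    | nil => simp
    | append_singleton u n ih =>
      rw [← List.append_assoc]
      exact ih.trans ((List.prefix_append _ _).trans (hφ_step _ _))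
  have hlen : ∀ (x : ℕ → ℕ) k, (φ (initSeg x k)).length < (φ (initSeg x (k + 1))).length :=
    fun x k => by
      rw [initSeg_succ]
      simpa using (hφ_step (initSeg x k) (x k)).length_le
  choose h hh using fun x => exists_mem_cyl_of_chain (fun k => φ (initSeg x k))
    (fun k => hφ_mono (initSeg_prefix x k.le_succ)) (hlen x)
  have hprefix : ∀ x k, initSeg (h x) k <+: φ (initSeg x k) := fun x k =>
    prefix_total_of_mem_cyl (mem_cyl_initSeg _ _) (hh x k)
      (by simpa using le_length_of_lt_succ (hlen x) k)
  refine ⟨h, continuous_iff_continuousAt.2 fun x => ?_, fun x k =>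
    Descriptive.Tree.mem_of_prefix (hprefix x k) (hφT _), ?_⟩
  · rw [ContinuousAt, tendsto_nhds]
    intro U hU hxU
    obtain ⟨n, hn⟩ := exists_cyl_subset hU hxU
    refine mem_of_superset ((isOpen_cyl (initSeg x n)).mem_nhds (mem_cyl_initSeg x n)) ?_
    intro y hy
    have hyx : initSeg y n = initSeg x n := by simpa [cyl] using hy
    exact hn n le_rfl (cyl_anti (hyx ▸ hprefix x n) (hh y n))
  · rintro X ⟨U, hU, hUX⟩
    -- The full-splitting nodes `w` of `U`, carried to `φ w`, split fully again, so fusion gives a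
    -- tree with body inside the image.
    let α := {w : List ℕ // w ∈ U ∧ succs U w ∈ ({Set.univ} : Set (Set ℕ))}
    let Rel : α → α → Prop := fun w v => w.1 <+: v.1 ∧ w.1.length < v.1.length
    have hstep : ∀ w : α, ∃ A ∈ ({Set.univ} : Set (Set ℕ)), ∀ n ∈ A,
        ∃ v : α, φ w.1 ++ [n] <+: φ v.1 ∧ Rel w v := by
      refine fun w => ⟨_, w.2.2, fun n hn => ?_⟩
      obtain ⟨v, h1, h2, h3⟩ := hU.2 _ hn
      exact ⟨⟨v, h1, h3⟩, (hφ_step w.1 n).trans (hφ_mono h2), (List.prefix_append _ _).trans h2,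
        by simpa using h2.length_le⟩
    obtain ⟨w₀, h₀, -, h₀'⟩ := hU.2 [] hU.1
    obtain ⟨S, hS, -, hbody⟩ :=
      exists_fusion isPosFamily_univ (fun w : α => φ w.1) Rel hstep ⟨w₀, h₀, h₀'⟩
    refine ⟨S, hS, fun x hx => ?_⟩
    obtain ⟨s, -, hs⟩ := hbody x hx
    obtain ⟨y, hy⟩ := exists_mem_cyl_of_chain (fun k => (s k).1) (fun k => (hs k).2.1.1)
      (fun k => (hs k).2.1.2)
    have hlen' := le_length_of_lt_succ (s := fun k => (s k).1) fun k => (hs k).2.1.2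
    refine ⟨y, hUX fun k => Descriptive.Tree.mem_of_prefix (prefix_total_of_mem_cyl
      (mem_cyl_initSeg y k) (hy k) (by simpa using hlen' k)) (s k).2.1, ?_⟩
    refine eq_of_forall_exists_cyl fun m => ⟨φ (s (m + 1)).1,
      le_length_of_lt_succ (s := fun k => φ (s k).1) (fun k => (hs k).2.2) (m + 1), ?_,
      (hs (m + 1)).1⟩
    have h1 := hh y (s (m + 1)).1.length
    rwa [show initSeg y (s (m + 1)).1.length = (s (m + 1)).1 from hy (m + 1)] at h1

end Cardinals

end MillerIdeals

theorem mainTheorem3 :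
    (∀ I : Order.Ideal (Set ℕ), I.IsProper → (∀ A : Set ℕ, A.Finite → A ∈ I) →
      (min MillerIdeals.boundingNumber
          (MillerIdeals.covH (MillerIdeals.borelPart (MillerIdeals.MillerTrees I)))
          ≤ MillerIdeals.shrinkNumH (MillerIdeals.MillerTrees I) ∧
        MillerIdeals.shrinkNumH (MillerIdeals.MillerTrees I)
          ≤ MillerIdeals.covH (MillerIdeals.borelPart (MillerIdeals.MillerTrees I))) ∧
      (MillerIdeals.Homogeneous (MillerIdeals.MillerTrees I) →
        min MillerIdeals.boundingNumber
          (MillerIdeals.cov (MillerIdeals.borelPart (MillerIdeals.MillerTrees I)))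
          ≤ MillerIdeals.shrinkNum (MillerIdeals.MillerTrees I) ∧
        MillerIdeals.shrinkNum (MillerIdeals.MillerTrees I)
          ≤ MillerIdeals.cov (MillerIdeals.borelPart (MillerIdeals.MillerTrees I)))) ∧
    (min MillerIdeals.boundingNumber
        (MillerIdeals.covH (MillerIdeals.borelPart MillerIdeals.FullMillerTrees))
        ≤ MillerIdeals.shrinkNumH MillerIdeals.FullMillerTrees ∧
      MillerIdeals.shrinkNumH MillerIdeals.FullMillerTrees
        ≤ MillerIdeals.covH (MillerIdeals.borelPart MillerIdeals.FullMillerTrees)) ∧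
    (min MillerIdeals.boundingNumber
        (MillerIdeals.cov (MillerIdeals.borelPart MillerIdeals.FullMillerTrees))
        ≤ MillerIdeals.shrinkNum MillerIdeals.FullMillerTrees ∧
      MillerIdeals.shrinkNum MillerIdeals.FullMillerTrees
        ≤ MillerIdeals.cov (MillerIdeals.borelPart MillerIdeals.FullMillerTrees)) := by
  refine ⟨fun I hI hfin => ?_, ?_⟩
  · have hP := MillerIdeals.isPosFamily_notMem_ideal hI hfin
    rw [MillerIdeals.millerTrees_eq]
    exact ⟨⟨MillerIdeals.min_le_shrinkNumH hP, MillerIdeals.shrinkNumH_le_covH hP⟩, fun hhom =>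
      ⟨MillerIdeals.min_le_shrinkNum hP fun _ hT => hhom.exists_continuous hT,
        MillerIdeals.shrinkNum_le_cov hP⟩⟩
  · have hP := MillerIdeals.isPosFamily_univ
    rw [MillerIdeals.fullMillerTrees_eq]
    exact ⟨⟨MillerIdeals.min_le_shrinkNumH hP, MillerIdeals.shrinkNumH_le_covH hP⟩,
      MillerIdeals.min_le_shrinkNum hP fun _ => MillerIdeals.exists_continuous_of_mem_full,
      MillerIdeals.shrinkNum_le_cov hP⟩
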